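/- Let $X$ be a compact Hausdorff space that is power homogeneous, i.e. there is a cardinal $\kappa\ge 1$ such that the product space $X^\kappa$ is homogeneous (a space $Y$ is homogeneous if for all $x,y\in Y$ there is a homeomorphism $h:Y\to Y$ with $h(x)=y$). Then $$|X|\le 2^{wt(X)\cdot\pi_\chi(X)}.$$ Here the tightness $t(Y)$ of a space $Y$ is the least infinite cardinal $\kappa$ such that whenever $A\subseteq Y$ and $x\in\overline{A}$ there is $B\subseteq A$ with $|B|\le\kappa$ and $x\in\overline{B}$. The weak tightness $wt(X)$ is the least infinite cardinal $\kappa$ for which there is a cover $\mathcal C$ of $X$ with $|\mathcal C|\le 2^\kappa$ such that for every $C\in\mathcal C$: (a) the subspace $C$ satisfies $t(C)\le\kappa$; and (b) $X=\bigcup\{\overline{B}: B\subseteq C,\ |B|\le 2^\kappa\}$. A local $\pi$-base at $x\in X$ is a family of nonempty open subsets of $X$ such that every open neighbourhood of $x$ contains a member of the family; $\pi_\chi(x,X)$ is the least cardinality of a local $\pi$-base at $x$, and $\pi_\chi(X)=\max\{\aleph_0,\ \sup_{x\in X}\pi_\chi(x,X)\}$. -/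

import Mathlib

open Cardinal

universe u

/-- The tightness `t(X)`: the least infinite cardinal `κ` such that, whenever `x ∈ closure A`,
there is `B ⊆ A` with `|B| ≤ κ` and `x ∈ closure B`. -/
noncomputable def tightness (X : Type u) [TopologicalSpace X] : Cardinal.{u} :=
  sInf {κ | ℵ₀ ≤ κ ∧ ∀ (A : Set X) (x : X), x ∈ closure A →
    ∃ B : Set X, B ⊆ A ∧ #B ≤ κ ∧ x ∈ closure B}

/-- The `κ`-closure of `A`: the union of the closures of the subsets of `A` of cardinality
at most `κ`. -/
def cardClosure {X : Type u} [TopologicalSpace X] (κ : Cardinal.{u}) (A : Set X) : Set X :=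
  {x | ∃ B : Set X, B ⊆ A ∧ #B ≤ κ ∧ x ∈ closure B}

/-- `𝒞` is a cover of `X` with `|𝒞| ≤ 2 ^ κ` such that every `C ∈ 𝒞`, with the subspace topology,
has tightness at most `κ`, and the `2 ^ κ`-closure of `C` is all of `X`. -/
def IsWeakTightnessCover {X : Type u} [TopologicalSpace X] (κ : Cardinal.{u})
    (𝒞 : Set (Set X)) : Prop :=
  ⋃₀ 𝒞 = Set.univ ∧ #𝒞 ≤ 2 ^ κ ∧
    ∀ C ∈ 𝒞, tightness C ≤ κ ∧ cardClosure (2 ^ κ) C = Set.univ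

/-- The weak tightness `wt(X)`: the least infinite `κ` admitting such a cover. -/
noncomputable def weakTightness (X : Type u) [TopologicalSpace X] : Cardinal.{u} :=
  sInf {κ | ℵ₀ ≤ κ ∧ ∃ 𝒞 : Set (Set X), IsWeakTightnessCover κ 𝒞}

/-- `𝒱` is a local π-base at `x`: a family of nonempty open sets such that every open
neighbourhood of `x` contains a member of the family. -/
def IsLocalPiBase {X : Type u} [TopologicalSpace X] (x : X) (𝒱 : Set (Set X)) : Prop :=
  (∀ V ∈ 𝒱, IsOpen V ∧ V.Nonempty) ∧ ∀ U : Set X, IsOpen U → x ∈ U → ∃ V ∈ 𝒱, V ⊆ U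

/-- The least cardinality of a local π-base at `x`. -/
noncomputable def piCharacterAt {X : Type u} [TopologicalSpace X] (x : X) : Cardinal.{u} :=
  sInf {κ | ∃ 𝒱 : Set (Set X), IsLocalPiBase x 𝒱 ∧ #𝒱 = κ}

/-- The π-character of `X`, with the usual convention that cardinal functions take infinite
values. -/
noncomputable def piCharacter (X : Type u) [TopologicalSpace X] : Cardinal.{u} :=
  max ℵ₀ (⨆ x : X, piCharacterAt x)

/-- Any point can be moved to any other by a self-homeomorphism. -/
def IsHomogeneousSpace (X : Type u) [TopologicalSpace X] : Prop :=
  ∀ x y : X, ∃ h : X ≃ₜ X, h x = y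

/-- Some power of `X`, with a nonempty exponent, is homogeneous in the product topology. -/
def IsPowerHomogeneous (X : Type u) [TopologicalSpace X] : Prop :=
  ∃ ι : Type u, Nonempty ι ∧ IsHomogeneousSpace (ι → X)

/-! Let κ be `wt(X) · πχ(X)`. It is enough to find a dense set of size at most `2 ^ κ`, since power
homogeneity then gives `|X| ≤ d(X) ^ κ` (`mk_le_power_of_dense`).

Weak tightness gives one good place: a nonempty intersection of at most κ open sets inside the
closure of a saturated set of size at most `2 ^ κ` (`exists_sInter_subset_closure`). There, `2 ^ κ`
open sets separate each point from all others. Homeomorphisms of the power carry this to every point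
of X. A homeomorphism followed by a coordinate projection is an open map f, and small π-character
makes κ coordinates decide membership in the fibres of f over all points of `closure A` when `|A| ≤
κ` (`exists_fiberDependsOn_closure`). Only κ coordinate maps are then needed to pull the separating
sets back. Counting subfamilies of the power set of A makes the result uniform on `closure A`, and a
closing-off argument of length κ⁺ yields the dense set. -/

/-! ### Coordinates that determine a fibre -/

theorem exists_finset_forall_eqOn_mem {ι X Y : Type*} [TopologicalSpace X] [CompactSpace X]
    [TopologicalSpace Y] [T1Space Y] {f : (ι → X) → Y} (hf : Continuous f) {V : Set Y}
    (hV : IsOpen V) {v : Y} (hv : v ∈ V) :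
    ∃ F : Finset ι, ∀ w w' : ι → X, f w = v → (∀ i ∈ F, w' i = w i) → f w' ∈ V := by
  classical
  have hbox : ∀ w : ι → X, ∃ (I : Finset ι) (O : ι → Set X), f w = v →
      (∀ i ∈ I, IsOpen (O i) ∧ w i ∈ O i) ∧ (I : Set ι).pi O ⊆ f ⁻¹' V := by
    intro w
    by_cases hw : f w = v
    · obtain ⟨I, O, h⟩ := isOpen_pi_iff.1 (hV.preimage hf) w (by simpa [hw] using hv)
      exact ⟨I, O, fun _ => h⟩
    · exact ⟨∅, fun _ => ∅, fun h => absurd h hw⟩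
  choose I O h using hbox
  -- The fibre is compact, so finitely many basic boxes cover it and one finite set of coordinates
  -- serves every `w` over `v`.
  have hcpt : IsCompact (f ⁻¹' {v}) := (isClosed_singleton.preimage hf).isCompact
  obtain ⟨t, ht, hcov⟩ := hcpt.elim_nhds_subcover (fun w => (I w : Set ι).pi (O w)) (by
    intro w hw
    exact (isOpen_set_pi (I w).finite_toSet fun i hi => ((h w hw).1 i hi).1).mem_nhds
      fun i hi => ((h w hw).1 i hi).2)
  refine ⟨t.biUnion I, fun w w' hw hww' => ?_⟩
  obtain ⟨w₀, hw₀, hmem⟩ := Set.mem_iUnion₂.1 (hcov (show w ∈ f ⁻¹' {v} from hw))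
  refine (h w₀ (ht w₀ hw₀)).2 fun i hi => ?_
  rw [hww' i (Finset.mem_biUnion.2 ⟨w₀, hw₀, hi⟩)]
  exact hmem i hi

/-- The fibre of `f` over `y` depends only on the coordinates in `B`. -/
def FiberDependsOn {ι X Y : Type*} (f : (ι → X) → Y) (B : Set ι) (y : Y) : Prop :=
  ∀ w w' : ι → X, f w = y → (∀ i ∈ B, w' i = w i) → f w' = y

theorem FiberDependsOn.mono {ι X Y : Type*} {f : (ι → X) → Y} {B B' : Set ι} {y : Y}
    (h : FiberDependsOn f B y) (hB : B ⊆ B') : FiberDependsOn f B' y :=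
  fun w w' hw hww' => h w w' hw fun i hi => hww' i (hB hi)

theorem continuous_piecewise_const {ι X : Type*} [TopologicalSpace X] (B : Set ι)
    [∀ i, Decidable (i ∈ B)] (w' : ι → X) :
    Continuous fun r : ι → X => B.piecewise r w' := by
  refine continuous_pi fun i => ?_
  by_cases hi : i ∈ B
  · simpa [hi] using continuous_apply i
  · simpa [hi] using continuous_const

/-- Each `V` in the π-base contributes the finitely many coordinates that keep `f` in `V` over one
chosen `v ∈ V`. If changing `w` off `B` moved `f w` away from `y`, the same would hold for all `r`
near `w`. Their images form a neighbourhood of `y`, hence include some `v`, and over that `v` the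
change cannot leave `V`. -/
theorem exists_fiberDependsOn {ι X Y : Type u} [TopologicalSpace X] [CompactSpace X]
    [TopologicalSpace Y] [T2Space Y] {f : (ι → X) → Y} (hf : Continuous f) (ho : IsOpenMap f)
    {κ : Cardinal.{u}} (hκ : ℵ₀ ≤ κ) {y : Y} {𝒱 : Set (Set Y)} (h𝒱 : IsLocalPiBase y 𝒱)
    (hc : #𝒱 ≤ κ) : ∃ B : Set ι, #B ≤ κ ∧ FiberDependsOn f B y := by
  classical
  have hV : ∀ V : 𝒱, ∃ (v : Y) (F : Finset ι), v ∈ V.1 ∧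
      ∀ w w' : ι → X, f w = v → (∀ i ∈ F, w' i = w i) → f w' ∈ V.1 := by
    intro V
    obtain ⟨hVo, v, hv⟩ := h𝒱.1 V V.2
    obtain ⟨F, hF⟩ := exists_finset_forall_eqOn_mem hf hVo hv
    exact ⟨v, F, hv, hF⟩
  choose v F hv hF using hV
  refine ⟨⋃ V, (F V : Set ι), ?_, ?_⟩
  · refine (mk_iUnion_le _).trans ((mul_le_mul' hc (ciSup_le' fun V => ?_)).trans
      (mul_eq_self hκ).le)
    exact ((F V).finite_toSet.lt_aleph0.le).trans hκ
  · intro w w' hw hww'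
    by_contra hne
    obtain ⟨W₀, V₀, hW₀, hV₀, hwW, hyV, hdisj⟩ := t2_separation hne
    set B := ⋃ V, (F V : Set ι) with hB
    set N := (fun r : ι → X => B.piecewise r w') ⁻¹' (f ⁻¹' W₀) with hN
    have hNo : IsOpen N := (hW₀.preimage hf).preimage (continuous_piecewise_const B w')
    have hwN : w ∈ N := by
      have : B.piecewise w w' = w' := by
        ext i
        by_cases hi : i ∈ B
        · simp [hi, hww' i hi]
        · simp [hi]
      simpa [hN, this] using hwW
    obtain ⟨V, hV, hVsub⟩ := h𝒱.2 (f '' N ∩ V₀) ((ho N hNo).inter hV₀)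
      ⟨⟨w, hwN, hw⟩, hyV⟩
    obtain ⟨⟨r, hrN, hr⟩, -⟩ := hVsub (hv ⟨V, hV⟩)
    have := hF ⟨V, hV⟩ r (B.piecewise r w') hr fun i hi => by
      have : i ∈ B := Set.mem_iUnion.2 ⟨⟨V, hV⟩, hi⟩
      simp [this]
    exact Set.disjoint_left.1 hdisj hrN (hVsub this).2

theorem FiberDependsOn.of_mem_closure {ι X Y : Type*} [TopologicalSpace X]
    [TopologicalSpace Y] [T2Space Y] {f : (ι → X) → Y} (hf : Continuous f) (ho : IsOpenMap f)
    {A : Set Y} {B : Set ι} (hB : ∀ a ∈ A, FiberDependsOn f B a) {y : Y} (hy : y ∈ closure A) :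
    FiberDependsOn f B y := by
  classical
  intro w w' hw hww'
  by_contra hne
  obtain ⟨W₀, V₀, hW₀, hV₀, hwW, hyV, hdisj⟩ := t2_separation hne
  set N := (fun r : ι → X => B.piecewise r w') ⁻¹' (f ⁻¹' W₀) with hN
  have hNo : IsOpen N := (hW₀.preimage hf).preimage (continuous_piecewise_const B w')
  have hwN : w ∈ N := by
    have : B.piecewise w w' = w' := by
      ext i
      by_cases hi : i ∈ B
      · simp [hi, hww' i hi]
      · simp [hi]
    simpa [hN, this] using hwW
  obtain ⟨_, ⟨⟨r, hrN, rfl⟩, hrV⟩, ha⟩ := mem_closure_iff.1 hy (f '' N ∩ V₀)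
    ((ho N hNo).inter hV₀) ⟨⟨w, hwN, hw⟩, hyV⟩
  have := hB _ ha r (B.piecewise r w') rfl fun i hi => by simp [hi]
  rw [← this] at hrV
  exact Set.disjoint_left.1 hdisj hrN hrV

theorem exists_fiberDependsOn_closure {ι X Y : Type u} [TopologicalSpace X] [CompactSpace X]
    [TopologicalSpace Y] [T2Space Y] {f : (ι → X) → Y} (hf : Continuous f) (ho : IsOpenMap f)
    {κ : Cardinal.{u}} (hκ : ℵ₀ ≤ κ)
    (hπ : ∀ y : Y, ∃ 𝒱 : Set (Set Y), IsLocalPiBase y 𝒱 ∧ #𝒱 ≤ κ) {A : Set Y} (hA : #A ≤ κ) :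
    ∃ B : Set ι, #B ≤ κ ∧ ∀ y ∈ closure A, FiberDependsOn f B y := by
  have : ∀ y : Y, ∃ B : Set ι, #B ≤ κ ∧ FiberDependsOn f B y := fun y => by
    obtain ⟨𝒱, h𝒱, hc⟩ := hπ y
    exact exists_fiberDependsOn hf ho hκ h𝒱 hc
  choose B hBc hB using this
  refine ⟨⋃ a : A, B a, ?_, fun y hy => ?_⟩
  · exact (mk_iUnion_le _).trans ((mul_le_mul' hA (ciSup_le' fun a : A => hBc a)).trans
      (mul_eq_self hκ).le)
  · exact FiberDependsOn.of_mem_closure hf ho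
      (fun a ha => (hB a).mono (Set.subset_iUnion (fun a : A => B a) ⟨a, ha⟩)) hy

/-! ### Cardinal arithmetic and recursion of length κ⁺ -/

theorem mk_iUnion_le_of_forall_le {ι α : Type u} {c : Cardinal.{u}} (hc : ℵ₀ ≤ c) (hι : #ι ≤ c)
    {f : ι → Set α} (hf : ∀ i, #(f i) ≤ c) : #(⋃ i, f i) ≤ c :=
  (mk_iUnion_le f).trans ((mul_le_mul' hι (ciSup_le' hf)).trans (mul_eq_self hc).le)

theorem mk_union_le_of_le {α : Type u} {c : Cardinal.{u}} (hc : ℵ₀ ≤ c) {s t : Set α}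
    (hs : #s ≤ c) (ht : #t ≤ c) : #(s ∪ t : Set α) ≤ c :=
  (mk_union_le s t).trans ((add_le_add hs ht).trans (add_eq_self hc).le)

theorem aleph0_le_two_power {κ : Cardinal.{u}} (hκ : ℵ₀ ≤ κ) : ℵ₀ ≤ (2 : Cardinal.{u}) ^ κ :=
  hκ.trans (cantor κ).le

theorem two_power_power {κ : Cardinal.{u}} (hκ : ℵ₀ ≤ κ) :
    ((2 : Cardinal.{u}) ^ κ) ^ κ = 2 ^ κ := by
  rw [← power_mul, mul_eq_self hκ]

theorem mk_subsets_le {X : Type u} {κ : Cardinal.{u}} (hκ : ℵ₀ ≤ κ) {D : Set X}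
    (hD : #D ≤ 2 ^ κ) : #{t : Set X // t ⊆ D ∧ #t ≤ κ} ≤ 2 ^ κ := by
  refine (mk_bounded_subset_le D κ).trans ?_
  rw [← two_power_power hκ]
  exact power_le_power_right (max_le hD (aleph0_le_two_power hκ))

/-- A well-ordered type of order type `κ⁺`. -/
abbrev SuccType (κ : Cardinal.{u}) : Type u := (Order.succ κ).ord.ToType

theorem mk_succType (κ : Cardinal.{u}) : #(SuccType κ) = Order.succ κ := mk_ord_toType _

instance (κ : Cardinal.{u}) : Nonempty (SuccType κ) :=
  mk_ne_zero_iff.1 (by rw [mk_succType]; exact (Order.bot_lt_succ κ).ne')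

theorem mk_succType_le (κ : Cardinal.{u}) : #(SuccType κ) ≤ 2 ^ κ := by
  rw [mk_succType]; exact Order.succ_le_of_lt (cantor κ)

theorem mk_Iio_succType_le {κ : Cardinal.{u}} (a : SuccType κ) : #(Set.Iio a) ≤ κ :=
  Order.lt_succ_iff.1 (by simpa using mk_Iio_lt a (by simp))

theorem exists_forall_lt_succType {κ : Cardinal.{u}} (hκ : ℵ₀ ≤ κ) {S : Set (SuccType κ)}
    (hS : #S ≤ κ) : ∃ a, ∀ b ∈ S, b < a := by
  by_contra! h
  have h1 := Order.cof_le (s := S) fun a => h a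
  rw [Ordinal.cof_toType] at h1
  exact absurd (((isRegular_succ hκ).le_cof_ord.trans h1).trans hS)
    (Order.lt_succ κ).not_ge

/-- The requirement is guaranteed only at stages where it can be met, so solvability may be proved
afterwards by induction along the constructed sequence. -/
theorem exists_forall_of_wellFoundedLT {W Y : Type*} [LinearOrder W] [WellFoundedLT W] [Nonempty Y]
    (P : ∀ a : W, (Set.Iio a → Y) → Y → Prop) :
    ∃ F : W → Y, ∀ a, (∃ y, P a (fun b => F b) y) → P a (fun b => F b) (F a) := by
  classical
  let F : W → Y := wellFounded_lt.fix fun a prev =>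
    Classical.epsilon (P a fun b => prev b.1 b.2)
  refine ⟨F, fun a h => ?_⟩
  have : F a = Classical.epsilon (P a fun b => F b) := WellFounded.fix_eq _ _ _
  rw [this]
  exact Classical.epsilon_spec h

/-- By regularity of κ⁺, a subset of size at most κ already lies in some stage. `Φ` need not be
monotone, so it is applied to the stage `E` and not to `A`. -/
theorem exists_closed_under_setOperator {X : Type u} {κ : Cardinal.{u}} (hκ : ℵ₀ ≤ κ)
    (Φ : Set X → Set X) (hΦ : ∀ D : Set X, #D ≤ 2 ^ κ → #(Φ D) ≤ 2 ^ κ) :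
    ∃ D : Set X, #D ≤ 2 ^ κ ∧ ∀ A ⊆ D, #A ≤ κ → ∃ E ⊆ D, A ⊆ E ∧ Φ E ⊆ D := by
  obtain ⟨F, hF⟩ := exists_forall_of_wellFoundedLT (W := SuccType κ) (Y := Set X)
    fun a prev y => y = (⋃ b, prev b) ∪ Φ (⋃ b, prev b)
  replace hF := fun a => hF a ⟨_, rfl⟩
  have h2 := aleph0_le_two_power hκ
  have hU : ∀ a, (∀ b < a, #(F b) ≤ 2 ^ κ) → #(⋃ b : Set.Iio a, F b) ≤ 2 ^ κ := fun a h =>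
    mk_iUnion_le_of_forall_le h2 ((mk_Iio_succType_le a).trans (cantor κ).le) fun b => h b b.2
  have hcard : ∀ a, #(F a) ≤ 2 ^ κ := by
    intro a
    induction a using WellFoundedLT.induction with
    | ind a ih =>
      rw [hF a]
      exact mk_union_le_of_le h2 (hU a ih) (hΦ _ (hU a ih))
  refine ⟨⋃ a, F a, mk_iUnion_le_of_forall_le h2 (mk_succType_le κ) hcard, fun A hA hAc => ?_⟩
  choose! g hg using fun x (hx : x ∈ A) => Set.mem_iUnion.1 (hA hx)
  obtain ⟨a, ha⟩ := exists_forall_lt_succType hκ (S := g '' A) (mk_image_le.trans hAc)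
  refine ⟨⋃ b : Set.Iio a, F b, Set.iUnion_subset fun b => Set.subset_iUnion F b.1, ?_, ?_⟩
  · intro x hx
    exact Set.mem_iUnion.2 ⟨⟨g x, ha _ (Set.mem_image_of_mem g hx)⟩, hg x hx⟩
  · refine Set.Subset.trans ?_ (Set.subset_iUnion F a)
    rw [hF a]
    exact Set.subset_union_right

/-! ### Saturated sets -/

/-- Each member of `𝒞` meets `D` in a set whose closure contains `D`. -/
def SaturatedFor {X : Type*} [TopologicalSpace X] (𝒞 : Set (Set X)) (D : Set X) : Prop :=
  ∀ y ∈ D, ∀ C ∈ 𝒞, y ∈ closure (D ∩ C)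

theorem SaturatedFor.iUnion {X : Type*} {ι : Sort*} [TopologicalSpace X] {𝒞 : Set (Set X)}
    {D : ι → Set X} (h : ∀ i, SaturatedFor 𝒞 (D i)) : SaturatedFor 𝒞 (⋃ i, D i) := by
  intro y hy C hC
  obtain ⟨i, hi⟩ := Set.mem_iUnion.1 hy
  exact closure_mono (Set.inter_subset_inter_left C (Set.subset_iUnion D i)) (h i y hi C hC)

section Cover

variable {X : Type u} [TopologicalSpace X] {κ : Cardinal.{u}} {𝒞 : Set (Set X)}

/-- A point `z` of the closure lies in some `C`, and saturation puts it in the closure of `D ∩ C`,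
where the tightness of `C` applies. -/
theorem SaturatedFor.closure_subset_cardClosure {D : Set X} (hD : SaturatedFor 𝒞 D)
    (hcov : ⋃₀ 𝒞 = Set.univ)
    (ht : ∀ C ∈ 𝒞, ∀ A ⊆ C, ∀ x ∈ C, x ∈ closure A → x ∈ cardClosure κ A) :
    closure D ⊆ cardClosure κ D := by
  intro z hz
  obtain ⟨C, hC, hzC⟩ := Set.mem_sUnion.1 (hcov.symm ▸ Set.mem_univ z : z ∈ ⋃₀ 𝒞)
  have hz' : z ∈ closure (D ∩ C) :=
    closure_minimal (fun y hy => hD y hy C hC) isClosed_closure hz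
  obtain ⟨B, hB, hBc, hzB⟩ := ht C hC (D ∩ C) Set.inter_subset_right z hzC hz'
  exact ⟨B, hB.trans Set.inter_subset_left, hBc, hzB⟩

theorem exists_saturatedFor (hκ : ℵ₀ ≤ κ) (hcard : #𝒞 ≤ 2 ^ κ)
    (hd : ∀ C ∈ 𝒞, cardClosure (2 ^ κ) C = Set.univ) (x : X) :
    ∃ D : Set X, x ∈ D ∧ #D ≤ 2 ^ κ ∧ SaturatedFor 𝒞 D := by
  have h2 := aleph0_le_two_power hκ
  have hb : ∀ (C : 𝒞) (y : X), ∃ B : Set X, B ⊆ C ∧ #B ≤ 2 ^ κ ∧ y ∈ closure B := fun C y => by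
    have : y ∈ cardClosure (2 ^ κ) C.1 := by rw [hd C C.2]; trivial
    exact this
  choose b hbC hbc hb using hb
  let S : ℕ → Set X := fun n => n.rec {x} fun _ E => ⋃ y : E, ⋃ C : 𝒞, b C y
  have hS : ∀ n, #↥(S n) ≤ 2 ^ κ := by
    intro n
    induction n with
    | zero => exact (by simpa [S] using one_le_aleph0.trans h2)
    | succ n ih =>
      exact mk_iUnion_le_of_forall_le h2 ih fun y =>
        mk_iUnion_le_of_forall_le h2 hcard fun C => by exact hbc C y.1
  refine ⟨⋃ n : ULift.{u} ℕ, S n.down, Set.mem_iUnion.2 ⟨⟨0⟩, rfl⟩,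
    mk_iUnion_le_of_forall_le h2 (by simpa using h2) fun n => hS n.down, ?_⟩
  intro y hy C hC
  obtain ⟨⟨n⟩, hn⟩ := Set.mem_iUnion.1 hy
  refine closure_mono ?_ (hb ⟨C, hC⟩ y)
  refine Set.subset_inter (fun z hz => ?_) (hbC ⟨C, hC⟩ y)
  exact Set.mem_iUnion.2 ⟨⟨n + 1⟩,
    Set.mem_iUnion.2 ⟨⟨y, hn⟩, Set.mem_iUnion.2 ⟨⟨C, hC⟩, hz⟩⟩⟩

end Cover

/-! ### A small intersection of open sets inside a small closure -/

theorem exists_isClosed_isGδ_disjoint {X : Type*} [TopologicalSpace X] [NormalSpace X]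
    [T1Space X] {F : Set X} (hF : IsClosed F) {y : X} (hy : y ∉ F) :
    ∃ Z : Set X, IsClosed Z ∧ IsGδ Z ∧ y ∈ Z ∧ Disjoint Z F := by
  obtain ⟨f, h0, h1, -⟩ := exists_continuous_zero_one_of_isClosed (isClosed_singleton (x := y)) hF
    (Set.disjoint_singleton_left.2 hy)
  refine ⟨f ⁻¹' {0}, isClosed_singleton.preimage f.continuous,
    IsGδ.preimage f.continuous (IsGδ.singleton 0), h0 rfl, ?_⟩
  rw [Set.disjoint_left]
  intro x hx hxF
  have := (h1 hxF).symm.trans hx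
  simp at this

/-- Otherwise a sequence of length κ⁺ can be built: each new point lies in all earlier closed Gδ
sets, and its own Gδ misses the closure of the saturated set generated so far. A cluster point of
all tails lies in every Gδ, yet by saturation it is in the closure of κ many generated points, hence
in the closure of an initial part that a later Gδ avoids. -/
theorem exists_sInter_subset_closure {X : Type u} [TopologicalSpace X] [CompactSpace X] [T2Space X]
    [Nonempty X] {κ : Cardinal.{u}} (hκ : ℵ₀ ≤ κ) {𝒞 : Set (Set X)} (hcov : ⋃₀ 𝒞 = Set.univ)
    (hcard : #𝒞 ≤ 2 ^ κ)
    (ht : ∀ C ∈ 𝒞, ∀ A ⊆ C, ∀ x ∈ C, x ∈ closure A → x ∈ cardClosure κ A)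
    (hd : ∀ C ∈ 𝒞, cardClosure (2 ^ κ) C = Set.univ) :
    ∃ (𝒢 : Set (Set X)) (H : Set X), #𝒢 ≤ κ ∧ (∀ O ∈ 𝒢, IsOpen O) ∧ (⋂₀ 𝒢).Nonempty ∧
      #H ≤ 2 ^ κ ∧ SaturatedFor 𝒞 H ∧ ⋂₀ 𝒢 ⊆ closure H := by
  by_contra! hno
  have h2 := aleph0_le_two_power hκ
  choose s hxs hsc hs using exists_saturatedFor hκ hcard hd
  obtain ⟨F, hF⟩ := exists_forall_of_wellFoundedLT (W := SuccType κ) (Y := X × Set X)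
    fun a prev y => (∀ b, y.1 ∈ (prev b).2) ∧ y.1 ∈ y.2 ∧ IsClosed y.2 ∧ IsGδ y.2 ∧
      Disjoint y.2 (closure (⋃ b, s (prev b).1))
  have key : ∀ a, (∀ b < a, (F a).1 ∈ (F b).2) ∧ (F a).1 ∈ (F a).2 ∧ IsClosed (F a).2 ∧
      IsGδ (F a).2 ∧ Disjoint (F a).2 (closure (⋃ b : Set.Iio a, s (F b).1)) := by
    intro a
    induction a using WellFoundedLT.induction with
    | ind a ih =>
      suffices h : ∃ y : X × Set X, (∀ b : Set.Iio a, y.1 ∈ (F b).2) ∧ y.1 ∈ y.2 ∧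
          IsClosed y.2 ∧ IsGδ y.2 ∧ Disjoint y.2 (closure (⋃ b : Set.Iio a, s (F b).1)) by
        obtain ⟨h1, h2⟩ := hF a h
        exact ⟨fun b hb => h1 ⟨b, hb⟩, h2⟩
      -- For finitely many indices, the point chosen at the largest one lies in all the sets.
      have hne : (⋂ b : Set.Iio a, (F b).2).Nonempty := by
        refine CompactSpace.iInter_nonempty (fun b => (ih b b.2).2.2.1) fun t => ?_
        rcases t.eq_empty_or_nonempty with rfl | hne
        · simp
        · refine ⟨(F (t.max' hne)).1, Set.mem_iInter₂.2 fun b hb => ?_⟩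
          rcases (t.le_max' b hb).lt_or_eq with hlt | heq
          · exact (ih _ (t.max' hne).2).1 b hlt
          · rw [← heq]; exact (ih b b.2).2.1
      choose T hTo hTc hT using fun b : Set.Iio a => (ih b b.2).2.2.2.1
      have hG : ⋂₀ (⋃ b, T b) = ⋂ b : Set.Iio a, (F b).2 := by
        rw [Set.sInter_iUnion]
        exact Set.iInter_congr fun b => (hT b).symm
      have hsub := hno (⋃ b, T b) (⋃ b : Set.Iio a, s (F b).1)
        (mk_iUnion_le_of_forall_le hκ (mk_Iio_succType_le a)
          fun b => (hTc b).le_aleph0.trans hκ)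
        (fun O hO => by
          obtain ⟨b, hb⟩ := Set.mem_iUnion.1 hO
          exact hTo b O hb)
        (hG ▸ hne)
        (mk_iUnion_le_of_forall_le h2 ((mk_Iio_succType_le a).trans (cantor κ).le)
          fun b => hsc _)
        (SaturatedFor.iUnion fun b => hs _)
      rw [hG] at hsub
      obtain ⟨y, hy, hyn⟩ := Set.not_subset.1 hsub
      obtain ⟨Z, hZc, hZδ, hyZ, hZd⟩ := exists_isClosed_isGδ_disjoint isClosed_closure hyn
      exact ⟨(y, Z), fun b => Set.mem_iInter.1 hy b, hyZ, hZc, hZδ, hZd⟩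
  obtain ⟨z, hz⟩ : (⋂ a, closure ((fun b => (F b).1) '' Set.Ici a)).Nonempty := by
    refine CompactSpace.iInter_nonempty (fun _ => isClosed_closure) fun t => ?_
    obtain ⟨m, hm⟩ : ∃ m, ∀ b ∈ t, b < m := exists_forall_lt_succType hκ (S := (t : Set _))
      (t.finite_toSet.lt_aleph0.le.trans hκ)
    exact ⟨(F m).1, Set.mem_iInter₂.2 fun b hb =>
      subset_closure (Set.mem_image_of_mem _ (hm b hb).le)⟩
  have hzZ : ∀ a, z ∈ (F a).2 := fun a => by
    refine closure_minimal ?_ (key a).2.2.1 (Set.mem_iInter.1 hz a)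
    rintro _ ⟨b, hb, rfl⟩
    rcases (show a ≤ b from hb).lt_or_eq with hlt | rfl
    · exact (key b).1 a hlt
    · exact (key a).2.1
  have hzD : z ∈ closure (⋃ b, s (F b).1) := by
    refine closure_mono ?_ (Set.mem_iInter.1 hz (Classical.arbitrary _))
    rintro _ ⟨b, -, rfl⟩
    exact Set.mem_iUnion.2 ⟨b, hxs _⟩
  obtain ⟨B, hB, hBc, hzB⟩ := (SaturatedFor.iUnion fun b => hs (F b).1).closure_subset_cardClosure
    hcov ht hzD
  choose! g hg using fun x (hx : x ∈ B) => Set.mem_iUnion.1 (hB hx)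
  obtain ⟨a, ha⟩ := exists_forall_lt_succType hκ (S := g '' B) (mk_image_le.trans hBc)
  refine Set.disjoint_left.1 (key a).2.2.2.2 (hzZ a) (closure_mono ?_ hzB)
  intro x hx
  exact Set.mem_iUnion.2 ⟨⟨g x, ha _ (Set.mem_image_of_mem g hx)⟩, hg x hx⟩

/-! ### Separating points by few open sets -/

/-- Some open member of `𝒪` contains `y` but not `q`, for each `q ≠ y`. -/
def SeparatesFromOthers {X : Type*} [TopologicalSpace X] (𝒪 : Set (Set X)) (y : X) : Prop :=
  ∀ q, q ≠ y → ∃ O ∈ 𝒪, IsOpen O ∧ y ∈ O ∧ q ∉ O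

theorem SeparatesFromOthers.mono {X : Type*} [TopologicalSpace X] {𝒪 𝒪' : Set (Set X)} {y : X}
    (h : SeparatesFromOthers 𝒪 y) (hs : 𝒪 ⊆ 𝒪') : SeparatesFromOthers 𝒪' y := fun q hq => by
  obtain ⟨O, hO, h'⟩ := h q hq
  exact ⟨O, hs hO, h'⟩

/-- A point `q` outside the intersection is excluded by a member of `𝒢`. Otherwise `q ∈ closure B`
for a small `B ⊆ H`, and removing from `B` a closed neighbourhood of `g` that misses `q` leaves a
set with `q`, but not `g`, in its closure. -/
theorem exists_separatesFromOthers_of_sInter_subset {X : Type u} [TopologicalSpace X]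
    [T3Space X] {κ : Cardinal.{u}} (hκ : ℵ₀ ≤ κ) {𝒢 : Set (Set X)} {H : Set X}
    (h𝒢c : #𝒢 ≤ κ) (h𝒢 : ∀ O ∈ 𝒢, IsOpen O) (hHc : #H ≤ 2 ^ κ) (hGH : ⋂₀ 𝒢 ⊆ cardClosure κ H) :
    ∃ 𝒩 : Set (Set X), #𝒩 ≤ 2 ^ κ ∧ ∀ g ∈ ⋂₀ 𝒢, SeparatesFromOthers 𝒩 g := by
  have h2 := aleph0_le_two_power hκ
  refine ⟨𝒢 ∪ Set.range fun E : {t : Set X // t ⊆ H ∧ #t ≤ κ} => (closure E.1)ᶜ,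
    mk_union_le_of_le h2 (h𝒢c.trans (cantor κ).le) (mk_range_le.trans (mk_subsets_le hκ hHc)),
    fun g hg q hq => ?_⟩
  by_cases hqG : q ∈ ⋂₀ 𝒢
  · obtain ⟨B, hB, hBc, hqB⟩ := hGH hqG
    obtain ⟨V, hgV, hVc, hVq⟩ := exists_mem_nhds_isClosed_subset (isOpen_compl_singleton.mem_nhds
      (show g ∈ ({q}ᶜ : Set X) from fun h => hq h.symm))
    refine ⟨_, Or.inr ⟨⟨B \ V, Set.sdiff_subset.trans hB,
      (mk_le_mk_of_subset Set.sdiff_subset).trans hBc⟩, rfl⟩, isClosed_closure.isOpen_compl, ?_, ?_⟩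
    · intro hg'
      obtain ⟨x, hxV, hx⟩ := mem_closure_iff_nhds.1 hg' V hgV
      exact hx.2 hxV
    · refine not_not.2 ?_
      have hq' : q ∈ closure (Vᶜ ∩ B) :=
        hVc.isOpen_compl.inter_closure ⟨fun h => hVq h rfl, hqB⟩
      have hsub : Vᶜ ∩ B ⊆ B \ V := fun x hx => ⟨hx.2, hx.1⟩
      exact closure_mono hsub hq'
  · simp only [Set.mem_sInter, not_forall] at hqG
    obtain ⟨O, hO, hqO⟩ := hqG
    exact ⟨O, Or.inl hO, h𝒢 O hO, hg O hO, hqO⟩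

/-- Separating families near one point of `X` are carried near any point of a small closure by
homeomorphisms of a power of `X`. -/
theorem exists_separatesFromOthers_near {X ι : Type u} [TopologicalSpace X] [CompactSpace X]
    [T2Space X] {κ : Cardinal.{u}} (hκ : ℵ₀ ≤ κ)
    (hπ : ∀ x : X, ∃ 𝒱 : Set (Set X), IsLocalPiBase x 𝒱 ∧ #𝒱 ≤ κ) (o : ι) {p z : X}
    (h : (ι → X) ≃ₜ (ι → X)) (hpz : h (fun _ => p) = fun _ => z)
    {𝒢 𝒩 : Set (Set X)} (h𝒢c : #𝒢 ≤ κ) (h𝒢 : ∀ O ∈ 𝒢, IsOpen O) (hp : p ∈ ⋂₀ 𝒢)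
    (h𝒩c : #𝒩 ≤ 2 ^ κ) (h𝒩 : ∀ g ∈ ⋂₀ 𝒢, SeparatesFromOthers 𝒩 g) {A : Set X} (hA : #A ≤ κ) :
    ∃ 𝒢' 𝒪 : Set (Set X), #𝒢' ≤ κ ∧ (∀ O ∈ 𝒢', IsOpen O ∧ z ∈ O) ∧ #𝒪 ≤ 2 ^ κ ∧
      ∀ y ∈ ⋂₀ 𝒢' ∩ closure A, SeparatesFromOthers 𝒪 y := by
  classical
  have h2 := aleph0_le_two_power hκ
  obtain ⟨B, hBc, hB⟩ := exists_fiberDependsOn_closure (f := fun w => h w o)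
    ((continuous_apply o).comp h.continuous) ((isOpenMap_eval o).comp h.isOpenMap) hκ hπ hA
  -- The `h`-preimage of the point with `y` in place `o` and `z` elsewhere lies in the fibre over
  -- `y`. By the choice of `B`, distinct `q` and `y ∈ closure A` give preimages that differ at a
  -- coordinate in `B`.
  let φ : ι → X → X := fun i y => h.symm (Function.update (fun _ => z) o y) i
  have hφ : ∀ i, Continuous (φ i) := fun i => (continuous_apply i).comp
    (h.symm.continuous.comp (continuous_const.update o continuous_id))
  have hφz : ∀ i, φ i z = p := fun i => by
    have : Function.update (fun _ : ι => z) o z = fun _ => z := Function.update_eq_self o _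
    simp only [φ, this]
    rw [← hpz, Homeomorph.symm_apply_apply]
  refine ⟨⋃ i : B, (fun O => φ i ⁻¹' O) '' 𝒢, ⋃ i : B, (fun O => φ i ⁻¹' O) '' 𝒩,
    mk_iUnion_le_of_forall_le hκ hBc fun i => mk_image_le.trans h𝒢c, ?_,
    mk_iUnion_le_of_forall_le h2 (hBc.trans (cantor κ).le) fun i => mk_image_le.trans h𝒩c, ?_⟩
  · intro O hO
    obtain ⟨i, O', hO', rfl⟩ := Set.mem_iUnion.1 hO
    exact ⟨(h𝒢 O' hO').preimage (hφ i), by simpa [hφz] using hp O' hO'⟩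
  · rintro y ⟨hyG, hyA⟩ q hq
    have hex : ∃ i ∈ B, φ i q ≠ φ i y := by
      by_contra! hcon
      refine hq ?_
      have := hB y hyA (h.symm (Function.update (fun _ => z) o y))
        (h.symm (Function.update (fun _ => z) o q)) (by simp) hcon
      simpa using this
    obtain ⟨i, hi, hne⟩ := hex
    obtain ⟨N, hN, hNo, hyN, hqN⟩ := h𝒩 (φ i y) (fun O hO =>
      hyG _ (Set.mem_iUnion.2 ⟨⟨i, hi⟩, Set.mem_image_of_mem _ hO⟩)) (φ i q) hne
    exact ⟨φ i ⁻¹' N, Set.mem_iUnion.2 ⟨⟨i, hi⟩, Set.mem_image_of_mem _ hN⟩,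
      hNo.preimage (hφ i), hyN, hqN⟩

/-- By regularity, each neighbourhood `O` of `z` can be replaced by some `E ⊆ A` with `z ∈ closure E
⊆ O`. So `z` is governed by a family of at most κ subsets of `A`. There are only `2 ^ κ` such
families, and one separating family is chosen for each. -/
theorem exists_separatesFromOthers_closure {X : Type u} [TopologicalSpace X] [T3Space X]
    {κ : Cardinal.{u}} (hκ : ℵ₀ ≤ κ) {A : Set X} (hA : #A ≤ κ)
    (hloc : ∀ z ∈ closure A, ∃ 𝒢 𝒪 : Set (Set X), #𝒢 ≤ κ ∧ (∀ O ∈ 𝒢, IsOpen O ∧ z ∈ O) ∧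
      #𝒪 ≤ 2 ^ κ ∧ ∀ y ∈ ⋂₀ 𝒢 ∩ closure A, SeparatesFromOthers 𝒪 y) :
    ∃ 𝒪 : Set (Set X), #𝒪 ≤ 2 ^ κ ∧ ∀ y ∈ closure A, SeparatesFromOthers 𝒪 y := by
  classical
  have h2 := aleph0_le_two_power hκ
  let Good : Set (Set X) → Set (Set X) → Prop := fun ℰ 𝒪 =>
    #𝒪 ≤ 2 ^ κ ∧ ∀ y ∈ closure A, (∀ E ∈ ℰ, y ∈ closure E) → SeparatesFromOthers 𝒪 y
  let 𝒪 : Set (Set X) → Set (Set X) := fun ℰ => if h : ∃ 𝒪, Good ℰ 𝒪 then h.choose else ∅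
  have hcard : ∀ ℰ, #↥(𝒪 ℰ) ≤ 2 ^ κ := fun ℰ => by
    by_cases h : ∃ 𝒪, Good ℰ 𝒪
    · simp only [𝒪, dif_pos h]; exact h.choose_spec.1
    · simp [𝒪, dif_neg h]
  refine ⟨⋃ ℰ : {t : Set (Set X) // t ⊆ 𝒫 A ∧ #t ≤ κ}, 𝒪 ℰ.1,
    mk_iUnion_le_of_forall_le h2 (mk_subsets_le hκ ?_) fun ℰ => hcard _, fun z hz => ?_⟩
  · rw [mk_powerset]
    exact power_le_power_left two_ne_zero hA
  · obtain ⟨𝒢, 𝒪', h𝒢c, h𝒢, h𝒪c, h𝒪⟩ := hloc z hz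
    have hE : ∀ O : 𝒢, ∃ E ⊆ A, z ∈ closure E ∧ closure E ⊆ O := fun O => by
      obtain ⟨V, hzV, hVc, hVO⟩ := exists_mem_nhds_isClosed_subset
        ((h𝒢 O O.2).1.mem_nhds (h𝒢 O O.2).2)
      refine ⟨interior V ∩ A, Set.inter_subset_right,
        isOpen_interior.inter_closure ⟨mem_interior_iff_mem_nhds.2 hzV, hz⟩, ?_⟩
      exact (closure_minimal (Set.inter_subset_left.trans interior_subset) hVc).trans hVO
    choose E hEA hzE hEO using hE
    have hex : ∃ 𝒪, Good (Set.range E) 𝒪 := ⟨𝒪', h𝒪c, fun y hy hyE =>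
      h𝒪 y ⟨fun O hO => hEO ⟨O, hO⟩ (hyE _ ⟨⟨O, hO⟩, rfl⟩), hy⟩⟩
    have hsub : 𝒪 (Set.range E) ⊆ ⋃ ℰ : {t : Set (Set X) // t ⊆ 𝒫 A ∧ #t ≤ κ}, 𝒪 ℰ.1 :=
      Set.subset_iUnion (fun ℰ : {t : Set (Set X) // t ⊆ 𝒫 A ∧ #t ≤ κ} => 𝒪 ℰ.1)
        ⟨Set.range E, Set.range_subset_iff.2 hEA, mk_range_le.trans h𝒢c⟩
    refine SeparatesFromOthers.mono ?_ hsub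
    simp only [𝒪, dif_pos hex]
    exact hex.choose_spec.2 z hz (by rintro _ ⟨O, rfl⟩; exact hzE O)

/-! ### A dense set of size `2 ^ κ` -/

theorem exists_dense_mk_le {X : Type u} [TopologicalSpace X] [CompactSpace X] [Nonempty X]
    {κ : Cardinal.{u}} (hκ : ℵ₀ ≤ κ) {s : X → Set X} (hsc : ∀ x, #(s x) ≤ 2 ^ κ)
    (hs : ∀ D : Set X, (∀ x ∈ D, s x ⊆ D) → closure D ⊆ cardClosure κ D)
    (hsep : ∀ A : Set X, #A ≤ κ →
      ∃ 𝒪 : Set (Set X), #𝒪 ≤ 2 ^ κ ∧ ∀ y ∈ closure A, SeparatesFromOthers 𝒪 y) :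
    ∃ D : Set X, #D ≤ 2 ^ κ ∧ Dense D := by
  classical
  have h2 := aleph0_le_two_power hκ
  choose! 𝒪 h𝒪c h𝒪 using hsep
  -- A point missed by `T`, or an arbitrary point if `T` covers X.
  let pt : Set (Set X) → X := fun T => Classical.epsilon fun x => x ∉ ⋃₀ T
  let Fam : Set X → Set (Set X) := fun D => ⋃ A : {t : Set X // t ⊆ D ∧ #t ≤ κ}, 𝒪 A.1
  let Φ : Set X → Set X := fun D =>
    (⋃ x : D, s x) ∪ Set.range fun T : Finset (Fam D) => pt ((↑) '' (T : Set (Fam D)))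
  have hFam : ∀ D : Set X, #D ≤ 2 ^ κ → #↥(Fam D) ≤ 2 ^ κ := fun D hD =>
    mk_iUnion_le_of_forall_le h2 (mk_subsets_le hκ hD) fun A => h𝒪c A.1 A.2.2
  have hΦ : ∀ D : Set X, #D ≤ 2 ^ κ → #↥(Φ D) ≤ 2 ^ κ := fun D hD => by
    refine mk_union_le_of_le h2 (mk_iUnion_le_of_forall_le h2 hD fun x => hsc x)
      (mk_range_le.trans ?_)
    rcases finite_or_infinite (Fam D) with hfin | hinf
    · exact (mk_lt_aleph0 (α := Finset (Fam D))).le.trans h2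
    · rw [mk_finset_of_infinite]; exact hFam D hD
  obtain ⟨D, hDc, hD⟩ := exists_closed_under_setOperator hκ Φ hΦ
  refine ⟨D, hDc, fun q => ?_⟩
  by_contra hq
  have hDs : closure D ⊆ cardClosure κ D := hs D fun x hx => by
    obtain ⟨E, -, hxE, hΦE⟩ := hD {x} (Set.singleton_subset_iff.2 hx)
      (by simpa using one_le_aleph0.trans hκ)
    exact (Set.subset_iUnion (fun x : E => s x) ⟨x, hxE rfl⟩).trans
      (Set.subset_union_left.trans hΦE)
  have hO : ∀ y : closure D, ∃ (A : Set X) (O : Set X), A ⊆ D ∧ #A ≤ κ ∧ O ∈ 𝒪 A ∧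
      IsOpen O ∧ (y : X) ∈ O ∧ q ∉ O := fun y => by
    obtain ⟨A, hA, hAc, hyA⟩ := hDs y.2
    obtain ⟨O, hO, h'⟩ := h𝒪 A hAc y hyA q (fun h => hq (h ▸ y.2))
    exact ⟨A, O, hA, hAc, hO, h'⟩
  choose A O hA hAc hOA hOo hyO hqO using hO
  obtain ⟨t, ht⟩ := (isClosed_closure (s := D)).isCompact.elim_finite_subcover O hOo
    fun y hy => Set.mem_iUnion.2 ⟨⟨y, hy⟩, hyO ⟨y, hy⟩⟩
  -- The finitely many sets `A y` lie in a single stage, so the finite subcover, which misses `q`,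
  -- was considered there and an uncovered point was put into `D`.
  obtain ⟨E, hED, hAE, hΦE⟩ := hD (⋃ y : t, A y) (Set.iUnion_subset fun y => hA y)
    (mk_iUnion_le_of_forall_le hκ (t.finite_toSet.lt_aleph0.le.trans hκ) fun y => hAc y)
  have hOF : ∀ y ∈ t, O y ∈ Fam E := fun y hy => Set.mem_iUnion.2
    ⟨⟨A y, (Set.subset_iUnion (fun y : t => A y) ⟨y, hy⟩).trans hAE, hAc y⟩, hOA y⟩
  let T : Finset (Fam E) := t.attach.image fun y : {y // y ∈ t} => ⟨O y, hOF y y.2⟩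
  have hT : ((↑) '' (T : Set (Fam E)) : Set (Set X)) = O '' t := by
    ext U
    simp only [T, Finset.coe_image, Set.image_image]
    constructor
    · rintro ⟨y, -, rfl⟩; exact ⟨y, y.2, rfl⟩
    · rintro ⟨y, hy, rfl⟩; exact ⟨⟨y, Finset.mem_coe.1 hy⟩, by simp, rfl⟩
  have hpt : pt (O '' t) ∉ ⋃₀ (O '' t) :=
    Classical.epsilon_spec (p := fun x => x ∉ ⋃₀ (O '' t)) ⟨q, by
      rintro ⟨_, ⟨y, -, rfl⟩, hy⟩; exact hqO y hy⟩
  have hmem : pt (O '' t) ∈ D := hΦE (Or.inr ⟨T, by simp only [hT]⟩)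
  obtain ⟨y, hy, h'⟩ := Set.mem_iUnion₂.1 (ht (subset_closure hmem))
  exact hpt ⟨O y, Set.mem_image_of_mem _ hy, h'⟩

/-! ### Bounding cardinality by density -/

/-- Every point of the compact set `(f ⁻¹' V)ᶜ` differs from `p` at a coordinate in `B`. Finitely
many Hausdorff separations at such coordinates suffice. -/
theorem exists_nhds_subset_of_fiberDependsOn {ι X Y : Type*} [Nonempty ι] [TopologicalSpace X]
    [CompactSpace X] [T2Space X] [TopologicalSpace Y] {f : (ι → X) → Y} (hf : Continuous f)
    {B : Set ι} {p : X} {x : Y} (hB : FiberDependsOn f B x) (hx : f (fun _ => p) = x)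
    {V : Set Y} (hV : IsOpen V) (hxV : x ∈ V) :
    ∃ (F : Finset ι) (N : Set X), (F : Set ι) ⊆ B ∧ IsOpen N ∧ p ∈ N ∧
      ∀ w : ι → X, (∀ i ∈ F, w i ∈ N) → f w ∈ V := by
  classical
  have hex : ∀ w : ι → X, ∃ (i : ι) (O N : Set X), f w ∉ V →
      i ∈ B ∧ IsOpen O ∧ IsOpen N ∧ w i ∈ O ∧ p ∈ N ∧ Disjoint O N := fun w => by
    by_cases hw : f w ∈ V
    · exact ⟨Classical.arbitrary ι, ∅, ∅, fun h => absurd hw h⟩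
    · have : ∃ i ∈ B, w i ≠ p := by
        by_contra! hcon
        exact hw (hB _ w hx hcon ▸ hxV)
      obtain ⟨i, hi, hne⟩ := this
      obtain ⟨O, N, h⟩ := t2_separation hne
      exact ⟨i, O, N, fun _ => ⟨hi, h⟩⟩
  choose i O N h using hex
  obtain ⟨t, ht, hcov⟩ := (hV.preimage hf).isClosed_compl.isCompact.elim_nhds_subcover
    (fun w => (fun r => r (i w)) ⁻¹' O w) fun w hw =>
      ((h w hw).2.1.preimage (continuous_apply _)).mem_nhds (h w hw).2.2.2.1
  refine ⟨t.image i, ⋂ w ∈ t, N w, ?_, isOpen_biInter_finset fun w hw => (h w (ht w hw)).2.2.1,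
    Set.mem_iInter₂.2 fun w hw => (h w (ht w hw)).2.2.2.2.1, fun w hw => ?_⟩
  · intro j hj
    obtain ⟨w, hw, rfl⟩ := Finset.mem_image.1 (Finset.mem_coe.1 hj)
    exact (h w (ht w hw)).1
  · by_contra hwV
    obtain ⟨r, hr, hwr⟩ := Set.mem_iUnion₂.1 (hcov (show w ∈ (f ⁻¹' V)ᶜ from hwV))
    exact Set.disjoint_left.1 (h r (ht r hr)).2.2.2.2.2 hwr
      (Set.mem_iInter₂.1 (hw _ (Finset.mem_image_of_mem i hr)) r hr)

/-- A power homogeneous compactum has at most `d(X) ^ πχ(X)` points. -/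
theorem mk_le_power_of_dense {X ι : Type u} [TopologicalSpace X] [CompactSpace X]
    [T2Space X] {κ : Cardinal.{u}} (hκ : ℵ₀ ≤ κ)
    (hπ : ∀ x : X, ∃ 𝒱 : Set (Set X), IsLocalPiBase x 𝒱 ∧ #𝒱 ≤ κ) (o : ι) (p : X)
    (hhom : ∀ x : X, ∃ h : (ι → X) ≃ₜ (ι → X), h (fun _ => p) = fun _ => x)
    {D : Set X} (hD : Dense D) : #X ≤ #D ^ κ := by
  classical
  have : Nonempty ι := ⟨o⟩
  choose h hh using hhom
  let f : X → (ι → X) → X := fun x w => h x w o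
  have hfc : ∀ x, Continuous (f x) := fun x => (continuous_apply o).comp (h x).continuous
  have hfo : ∀ x, IsOpenMap (f x) := fun x => (isOpenMap_eval o).comp (h x).isOpenMap
  have hfp : ∀ x, f x (fun _ => p) = x := fun x => congrFun (hh x) o
  have hB : ∀ x, ∃ B : Set ι, #B ≤ κ ∧ FiberDependsOn (f x) B x := fun x => by
    obtain ⟨𝒱, h𝒱, hc⟩ := hπ x
    exact exists_fiberDependsOn (hfc x) (hfo x) hκ h𝒱 hc
  choose B hBc hB using hB
  obtain ⟨K, rfl⟩ : ∃ K : Type u, #K = κ := ⟨κ.out, mk_out κ⟩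
  have hemb : ∀ x, Nonempty (B x ↪ K) := fun x => hBc x
  let e : ∀ x, B x ↪ K := fun x => (hemb x).some
  obtain ⟨𝒱, h𝒱, h𝒱c⟩ := hπ p
  -- Embedding each `B x` in the fixed set `K` lets all `x` share one set of codes. A point is then
  -- encoded by a function from the codes to `D`.
  let U : X → Finset K × 𝒱 → Set (ι → X) := fun x c =>
    {w | ∀ i : B x, e x i ∈ c.1 → w i ∈ c.2.1}
  have hUo : ∀ x c, IsOpen (U x c) := fun x c => by
    have hfin : {i : B x | e x i ∈ c.1}.Finite :=
      c.1.finite_toSet.preimage (e x).injective.injOn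
    have : U x c = ⋂ i ∈ {i : B x | e x i ∈ c.1}, (fun w : ι → X => w i) ⁻¹' c.2.1 := by
      ext w; simp [U]
    rw [this]
    exact hfin.isOpen_biInter fun i _ => (h𝒱.1 _ c.2.2).1.preimage (continuous_apply _)
  have hd : ∀ x c, ∃ d : D, (d : X) ∈ f x '' U x c := fun x c => by
    obtain ⟨v, hv⟩ := (h𝒱.1 _ c.2.2).2
    obtain ⟨d, hdU, hdD⟩ := hD.inter_open_nonempty _ (hfo x _ (hUo x c))
      ⟨_, Set.mem_image_of_mem _ (show (fun _ => v) ∈ U x c from fun _ _ => hv)⟩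
    exact ⟨⟨d, hdD⟩, hdU⟩
  choose d hd using hd
  have hinj : Function.Injective d := by
    intro x y hxy
    by_contra hne
    obtain ⟨V, W, hV, hW, hxV, hyW, hdisj⟩ := t2_separation hne
    obtain ⟨F, N, hFB, hNo, hpN, hN⟩ :=
      exists_nhds_subset_of_fiberDependsOn (hfc x) (hB x) (hfp x) hV hxV
    obtain ⟨F', N', hFB', hNo', hpN', hN'⟩ :=
      exists_nhds_subset_of_fiberDependsOn (hfc y) (hB y) (hfp y) hW hyW
    obtain ⟨T, hT, hTN⟩ := h𝒱.2 (N ∩ N') (hNo.inter hNo') ⟨hpN, hpN'⟩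
    -- One code holds the relevant coordinates of both points, so a common value of `d` would lie in
    -- both `V` and `W`.
    let c : Finset K × 𝒱 := ((F.subtype (· ∈ B x)).map (e x) ∪ (F'.subtype (· ∈ B y)).map (e y),
      ⟨T, hT⟩)
    obtain ⟨w, hw, hwd⟩ := hd x c
    obtain ⟨w', hw', hwd'⟩ := hd y c
    have h1 : (d x c : X) ∈ V := hwd ▸ hN w fun i hi => (hTN (hw ⟨i, hFB hi⟩
      (Finset.mem_union_left _ (Finset.mem_map_of_mem _ (Finset.mem_subtype.2 hi))))).1
    have h2 : (d y c : X) ∈ W := hwd' ▸ hN' w' fun i hi => (hTN (hw' ⟨i, hFB' hi⟩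
      (Finset.mem_union_right _ (Finset.mem_map_of_mem _ (Finset.mem_subtype.2 hi))))).2
    rw [hxy] at h1
    exact Set.disjoint_left.1 hdisj h1 h2
  have hDne : #D ≠ 0 := by
    have := hD.nonempty_iff.2 ⟨p⟩
    exact mk_ne_zero_iff.2 this.to_subtype
  refine (mk_le_of_injective hinj).trans ?_
  rw [← power_def, mk_prod, lift_id, lift_id]
  have : Infinite K := infinite_iff.2 hκ
  rw [mk_finset_of_infinite]
  exact power_le_power_left hDne ((mul_le_mul' le_rfl h𝒱c).trans (mul_eq_self hκ).le)

/-! ### Cardinal functions attain their values, and the conclusion -/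

theorem tightness_spec (X : Type u) [TopologicalSpace X] {κ : Cardinal.{u}}
    (h : tightness X ≤ κ) (A : Set X) (x : X) (hx : x ∈ closure A) : x ∈ cardClosure κ A := by
  have hmem : tightness X ∈ {κ | ℵ₀ ≤ κ ∧ ∀ (A : Set X) (x : X), x ∈ closure A →
      ∃ B : Set X, B ⊆ A ∧ #B ≤ κ ∧ x ∈ closure B} :=
    csInf_mem ⟨max ℵ₀ #X, le_max_left _ _, fun A x hx =>
      ⟨A, subset_rfl, (mk_set_le A).trans (le_max_right _ _), hx⟩⟩
  obtain ⟨B, hB, hBc, hxB⟩ := hmem.2 A x hx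
  exact ⟨B, hB, hBc.trans h, hxB⟩

theorem mem_cardClosure_of_tightness_le {X : Type u} [TopologicalSpace X] {κ : Cardinal.{u}}
    {C : Set X} (h : tightness C ≤ κ) {A : Set X} (hA : A ⊆ C) {x : X} (hxC : x ∈ C)
    (hx : x ∈ closure A) : x ∈ cardClosure κ A := by
  have hx' : (⟨x, hxC⟩ : C) ∈ closure ((↑) ⁻¹' A : Set C) := by
    rw [closure_subtype, Subtype.image_preimage_coe, Set.inter_eq_right.2 hA]
    exact hx
  obtain ⟨B, hB, hBc, hxB⟩ := tightness_spec C h _ _ hx'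
  exact ⟨(↑) '' B, Set.image_subset_iff.2 hB, mk_image_le.trans hBc, closure_subtype.1 hxB⟩

theorem weakTightness_spec (X : Type u) [TopologicalSpace X] :
    ℵ₀ ≤ weakTightness X ∧ ∃ 𝒞 : Set (Set X), IsWeakTightnessCover (weakTightness X) 𝒞 := by
  refine csInf_mem (s := {κ | ℵ₀ ≤ κ ∧ ∃ 𝒞 : Set (Set X), IsWeakTightnessCover κ 𝒞})
    ⟨max ℵ₀ #X, le_max_left _ _, {Set.univ}, by simp, ?_, ?_⟩
  · rw [mk_singleton]
    exact one_le_aleph0.trans (aleph0_le_two_power (le_max_left _ _))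
  · rintro _ rfl
    refine ⟨csInf_le' ⟨le_max_left _ _, fun A x hx => ⟨A, subset_rfl, ?_, hx⟩⟩, ?_⟩
    · exact (mk_set_le A).trans ((mk_univ (α := X)).le.trans (le_max_right _ _))
    · refine Set.eq_univ_of_forall fun x => ⟨{x}, Set.subset_univ _, ?_, subset_closure rfl⟩
      rw [mk_singleton]
      exact one_le_aleph0.trans (aleph0_le_two_power (le_max_left _ _))

theorem exists_isLocalPiBase_mk_le {X : Type u} [TopologicalSpace X] (x : X) :
    ∃ 𝒱 : Set (Set X), IsLocalPiBase x 𝒱 ∧ #𝒱 ≤ piCharacter X := by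
  obtain ⟨𝒱, h𝒱, hc⟩ : piCharacterAt x ∈ {κ | ∃ 𝒱 : Set (Set X), IsLocalPiBase x 𝒱 ∧ #𝒱 = κ} :=
    csInf_mem ⟨_, {V | IsOpen V ∧ V.Nonempty}, ⟨fun V hV => hV, fun U hU hxU =>
      ⟨U, ⟨hU, x, hxU⟩, subset_rfl⟩⟩, rfl⟩
  exact ⟨𝒱, h𝒱, hc.le.trans ((le_ciSup bddAbove_of_small x).trans (le_max_right _ _))⟩

theorem cardClosure_mono {X : Type u} [TopologicalSpace X] {κ κ' : Cardinal.{u}} (h : κ ≤ κ')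
    (A : Set X) : cardClosure κ A ⊆ cardClosure κ' A :=
  fun _ ⟨B, hB, hBc, hx⟩ => ⟨B, hB, hBc.trans h, hx⟩

theorem mainTheorem8 (X : Type u) [TopologicalSpace X] [CompactSpace X] [T2Space X]
    (hX : IsPowerHomogeneous X) :
    #X ≤ 2 ^ (weakTightness X * piCharacter X) := by
  rcases isEmpty_or_nonempty X with hE | hE
  · simp
  obtain ⟨ι, ⟨o⟩, hhom⟩ := hX
  obtain ⟨hwt, 𝒞, hcov, h𝒞c, h𝒞⟩ := weakTightness_spec X
  have hπ0 : ℵ₀ ≤ piCharacter X := le_max_left _ _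
  have hwκ : weakTightness X ≤ weakTightness X * piCharacter X :=
    le_mul_right (aleph0_pos.trans_le hπ0).ne'
  have hpκ : piCharacter X ≤ weakTightness X * piCharacter X :=
    le_mul_left (aleph0_pos.trans_le hwt).ne'
  generalize weakTightness X * piCharacter X = κ at hwκ hpκ
  have hκ : ℵ₀ ≤ κ := hwt.trans hwκ
  have h2w : (2 : Cardinal.{u}) ^ weakTightness X ≤ 2 ^ κ := power_le_power_left two_ne_zero hwκ
  have hπ : ∀ x : X, ∃ 𝒱 : Set (Set X), IsLocalPiBase x 𝒱 ∧ #𝒱 ≤ κ := fun x => by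
    obtain ⟨𝒱, h𝒱, hc⟩ := exists_isLocalPiBase_mk_le x
    exact ⟨𝒱, h𝒱, hc.trans hpκ⟩
  have hcard : #𝒞 ≤ 2 ^ κ := h𝒞c.trans h2w
  have ht : ∀ C ∈ 𝒞, ∀ A ⊆ C, ∀ x ∈ C, x ∈ closure A → x ∈ cardClosure κ A :=
    fun C hC A hA x hxC hx => mem_cardClosure_of_tightness_le ((h𝒞 C hC).1.trans hwκ) hA hxC hx
  have hd : ∀ C ∈ 𝒞, cardClosure (2 ^ κ) C = Set.univ := fun C hC =>
    Set.eq_univ_of_univ_subset ((h𝒞 C hC).2.symm.subset.trans (cardClosure_mono h2w C))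
  obtain ⟨𝒢, H, h𝒢c, h𝒢, ⟨p, hp⟩, hHc, hH, hGH⟩ :=
    exists_sInter_subset_closure hκ hcov hcard ht hd
  obtain ⟨𝒩, h𝒩c, h𝒩⟩ := exists_separatesFromOthers_of_sInter_subset hκ h𝒢c h𝒢 hHc
    (hGH.trans (hH.closure_subset_cardClosure hcov ht))
  -- Only diagonal points need moving: one good point `p` serves all of X.
  have hmove : ∀ x : X, ∃ h : (ι → X) ≃ₜ (ι → X), h (fun _ => p) = fun _ => x :=
    fun x => hhom _ _
  choose s hxs hsc hs using exists_saturatedFor hκ hcard hd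
  obtain ⟨D, hDc, hD⟩ := exists_dense_mk_le hκ hsc (fun D hDs => by
      -- A set closed under `s` is a union of saturated sets, hence saturated.
      have : D = ⋃ x : D, s x := Set.Subset.antisymm
        (fun x hx => Set.mem_iUnion.2 ⟨⟨x, hx⟩, hxs x⟩) (Set.iUnion_subset fun x => hDs x x.2)
      have hsat : SaturatedFor 𝒞 D := by
        rw [this]; exact SaturatedFor.iUnion fun x => hs _
      exact hsat.closure_subset_cardClosure hcov ht)
    fun A hA => exists_separatesFromOthers_closure hκ hA fun z _ => by
      obtain ⟨h, hz⟩ := hmove z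
      exact exists_separatesFromOthers_near hκ hπ o h hz h𝒢c h𝒢 hp h𝒩c h𝒩 hA
  calc #X ≤ #D ^ κ := mk_le_power_of_dense hκ hπ o p hmove hD
    _ ≤ (2 ^ κ) ^ κ := power_le_power_right hDc
    _ = 2 ^ κ := two_power_power hκ
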